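/- **Setting.** $\log$ is the logarithm to base $2$. A formula on $n$ variables is a De Morgan formula: a tree with leaves labelled by variables and with gates AND, OR (fan-in 2) and NOT; its size is its number of leaves. It is evaluated on inputs in $\{0,u,1\}^n$ by Kleene's three-valued logic. A resolution of $x\in\{0,u,1\}^n$ is a $y\in\{0,1\}^n$ that agrees with $x$ wherever $x_i\ne u$. A formula has a hazard at $x$ if it outputs $u$ at $x$ although it has one and the same Boolean value at all resolutions of $x$; it is hazard-free if it has no hazard. For $f:\{0,1\}^n\to\{0,1\}$ let $\mathrm{size}_F^u(f)$ be the minimal size of a hazard-free formula computing $f$, and $\mathrm{size}_F^+(f)$ the minimal size of a formula without NOT gates computing $f$ ($\infty$ if there is none). Let $\tilde f(x)=b\in\{0,1\}$ if $f(y)=b$ for all resolutions $y$ of $x$, and $\tilde f(x)=u$ otherwise. For $x,y\in\{0,1\}^n$ let $x+uy$ be $x$ with all coordinates $i$ such that $y_i=1$ replaced by $u$; the hazard-derivative $\mathrm{d}f(x;y)\in\{0,1\}$ is $1$ if $\tilde f(x+uy)=u$ and $0$ otherwise. A prime implicate of $f$ is a $p\in\{0,u,1\}^n$ with $\tilde f(p)=0$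 such that replacing any coordinate $p_i\neq u$ by $u$ makes the value of $\tilde f$ equal to $u$; $P_0^{(f)}$ is the set of prime implicates of $f$, and $P_0^{(f)}|_x$ is the set of those $p\in P_0^{(f)}$ of which $x\in\{0,1\}^n$ is a resolution. With high probability means with probability tending to $1$ as $n\to\infty$. **Theorem.** Let $f:\{0,1\}^n\to\{0,1\}$ be a uniformly random Boolean function. Then: 1. For every $\varepsilon>0$, with high probability $\mathrm{size}_F^u(f)\ \ge\ (1-\varepsilon)\,\dfrac{2^n}{\log n}$. 2. There is a sequence $\delta_n\ge 0$, $\delta_n\to 0$, such that with high probability $\mathrm{size}_F^u(f)\ \le\ 2^n\cdot n^{(1-\delta_n)\log n}$. 3. More sharply, there is a sequence $\delta_n\to 0$ such that with high probability $\mathrm{size}_F^u(f)\ \le\ 2^n\cdot \dfrac{n^{\log n}}{(\log n)^{(1-\delta_n)\log n}}$. 4. In particular $\mathrm{size}_F^u(f)=2^{(1+o(1))n}$ with high probability: there is a sequence $\delta_n\to0$ such that with high probability $2^{(1-\delta_n)n}\le \mathrm{size}_F^u(f)\le 2^{(1+\delta_n)n}$. 5. There is a sequence $\delta_n\to0$ such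 that with high probability the following holds for every set $X\subseteq\{0,1\}^n$ of minimal cardinality among the sets with $P_0^{(f)}=\bigcup_{x\in X}P_0^{(f)}|_x$: $$\Bigl(\sum_{x\in X}\mathrm{size}_F^+(\mathrm{d}f(x;\cdot))\Bigr)^{1-\delta_n}\ \le\ \mathrm{size}_F^u(f)\ \le\ \sum_{x\in X}\mathrm{size}_F^+(\mathrm{d}f(x;\cdot)).$$ -/

import Mathlib

open Filter Topology
open scoped ENNReal

namespace HazardFree

/-- Boolean functions on `n` variables. -/
abbrev BoolFun (n : ℕ) : Type := (Fin n → Bool) → Bool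

/-- The three values of Kleene logic: `some false` is 0, `some true` is 1 and `none` is the
unstable value u. -/
abbrev Ternary : Type := Option Bool

/-- The Kleene extension of the OR gate. -/
def Ternary.or : Ternary → Ternary → Ternary
  | some true, _ => some true
  | _, some true => some true
  | some false, some false => some false
  | _, _ => none

/-- The Kleene extension of the AND gate. -/
def Ternary.and : Ternary → Ternary → Ternary
  | some false, _ => some false
  | _, some false => some false
  | some true, some true => some true
  | _, _ => none

/-- The Kleene extension of the NOT gate. -/
def Ternary.not : Ternary → Ternary
  | some b => some (!b)
  | none => none

/-- A Boolean vector, seen as a (stable) ternary vector. -/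
def stable {n : ℕ} (y : Fin n → Bool) : Fin n → Ternary := fun i => some (y i)

/-- The order in which u lies below both 0 and 1 (and 0, 1 are incomparable), coordinatewise. -/
def LessStable {n : ℕ} (x y : Fin n → Ternary) : Prop := ∀ i, x i = none ∨ x i = y i

/-- The set `R(x)` of all resolutions of a ternary vector `x`. -/
def resolutions {n : ℕ} (x : Fin n → Ternary) : Set (Fin n → Bool) :=
  {y | LessStable x (stable y)}

/-- De Morgan formulas on `n` variables: the leaves are labelled with variables (there are no
constants), the gates are NOT, AND, OR. -/
inductive Formula (n : ℕ) : Type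
  | var : Fin n → Formula n
  | not : Formula n → Formula n
  | and : Formula n → Formula n → Formula n
  | or : Formula n → Formula n → Formula n

namespace Formula

variable {n : ℕ}

/-- The size of a formula: the number of its leaves. -/
def size : Formula n → ℕ
  | var _ => 1
  | not F => F.size
  | and F G => F.size + G.size
  | or F G => F.size + G.size

/-- The value of a formula at a ternary input. -/
def eval (x : Fin n → Ternary) : Formula n → Ternary
  | var i => x i
  | not F => Ternary.not (F.eval x)
  | and F G => Ternary.and (F.eval x) (G.eval x)
  | or F G => Ternary.or (F.eval x) (G.eval x)

/-- The formula has no negation gate. -/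
def IsMonotone : Formula n → Prop
  | var _ => True
  | not _ => False
  | and F G => F.IsMonotone ∧ G.IsMonotone
  | or F G => F.IsMonotone ∧ G.IsMonotone

/-- The formula computes the Boolean function `f`. -/
def Computes (F : Formula n) (f : BoolFun n) : Prop :=
  ∀ y : Fin n → Bool, F.eval (stable y) = some (f y)

/-- The formula has a hazard at `x`: it is constant on the resolutions of `x` and yet outputs u. -/
def HasHazardAt (F : Formula n) (x : Fin n → Ternary) : Prop :=
  F.eval x = none ∧ ∃ b : Bool, ∀ y ∈ resolutions x, F.eval (stable y) = some b

/-- The formula has no hazard. -/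
def IsHazardFree (F : Formula n) : Prop := ∀ x : Fin n → Ternary, ¬ F.HasHazardAt x

end Formula

/-- The minimal size of a hazard-free formula computing `f` (`⊤` if there is none, which happens
only for constant `f`). -/
noncomputable def hazardFreeSize {n : ℕ} (f : BoolFun n) : ℕ∞ :=
  ⨅ (F : Formula n) (_ : F.Computes f ∧ F.IsHazardFree), (F.size : ℕ∞)

/-- The minimal size of a monotone formula computing `f` (`⊤` if there is none, which happens
only if `f` is constant or not monotone). -/
noncomputable def monotoneSize {n : ℕ} (f : BoolFun n) : ℕ∞ :=
  ⨅ (F : Formula n) (_ : F.Computes f ∧ F.IsMonotone), (F.size : ℕ∞)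

open Classical in
/-- The hazard-free extension of `f`. -/
noncomputable def extension {n : ℕ} (f : BoolFun n) (x : Fin n → Ternary) : Ternary :=
  if ∀ y ∈ resolutions x, f y = false then some false
  else if ∀ y ∈ resolutions x, f y = true then some true
  else none

/-- The ternary vector `x + uy`: the coordinates `i` of `x` with `y i = 1` are made unstable. -/
def perturb {n : ℕ} (x y : Fin n → Bool) : Fin n → Ternary :=
  fun i => if y i then none else some (x i)

/-- The hazard-derivative `df(x; y)`: it is 1 if the hazard-free extension of `f` is u at `x + uy`,
and 0 otherwise (that is, if the extension still has the value `f x` there). -/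
noncomputable def hazardDerivative {n : ℕ} (f : BoolFun n) (x : Fin n → Bool) : BoolFun n :=
  fun y => decide (extension f (perturb x y) = none)

/-- The set of prime implicates of `f`. -/
def primeImplicates {n : ℕ} (f : BoolFun n) : Set (Fin n → Ternary) :=
  {p | extension f p = some false ∧
    ∀ i, p i ≠ none → extension f (Function.update p i none) = none}

/-- The prime implicates of `f` are the union over `x ∈ X` of those prime implicates that
derive `x`. -/
def Covers {n : ℕ} (f : BoolFun n) (X : Finset (Fin n → Bool)) : Prop :=
  primeImplicates f = ⋃ x ∈ X, {p ∈ primeImplicates f | LessStable p (stable x)}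

/-- A covering set of minimal size. -/
def IsMinimumCover {n : ℕ} (f : BoolFun n) (X : Finset (Fin n → Bool)) : Prop :=
  Covers f X ∧ ∀ Y : Finset (Fin n → Bool), Covers f Y → X.card ≤ Y.card

/-- The sum over `x ∈ X` of the monotone formula sizes of the hazard-derivatives `df(x; ·)`. -/
noncomputable def derivativeSum {n : ℕ} (f : BoolFun n) (X : Finset (Fin n → Bool)) : ℕ∞ :=
  ∑ x ∈ X, monotoneSize (hazardDerivative f x)

/-- The probability that a uniformly random Boolean function on `n` variables satisfies `P`. -/
noncomputable def uniformProb {n : ℕ} (P : BoolFun n → Prop) : ℝ :=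
  (Nat.card {f : BoolFun n // P f} : ℝ) / (Nat.card (BoolFun n) : ℝ)

/-- With high probability (as `n` tends to infinity), a uniformly random Boolean function on `n`
variables satisfies `P n`. -/
def WithHighProbability (P : (n : ℕ) → BoolFun n → Prop) : Prop :=
  Tendsto (fun n => uniformProb (P n)) atTop (𝓝 1)

end HazardFree

/-!
A hazard-free formula of size `s` is in particular one of at most `(16 n) ^ s` formulas up to the
function computed, so most functions need size `(1 - o(1)) 2 ^ n / log n`.

For the upper bound, let `X` be a set of points covering the prime implicates of `f`. A monotone
formula for `df(x; ·)`, with the variables where `x i = 1` negated, detects without hazards whether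
a ternary input has a resolution that is seen from `x` as a change of value. As every subcube on
which `f` is `0` lies in a prime implicate of some `x ∈ X` with `f x = 0`, the conjunction of these
formulas over all such `x` is a hazard-free formula for `f`.

A random `f` is not constant on any subcube of dimension at least `log n + 2`. Hence every
derivative `df(x; ·)` has at most `(e n / log n) ^ (log n + O(1))` zeros, and its conjunctive normal
form has size `n ^ (log n - log log n + O(1))`. There are at most `2 ^ n` points `x` to sum over.
-/

namespace HazardFree

open Finset ProbabilityTheory
open Real (logb)

section Probability

variable {n : ℕ}

theorem uniformProb_eq_uniformOn_real (P : BoolFun n → Prop) :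
    uniformProb P = (uniformOn Set.univ).real {f | P f} := by
  rw [MeasureTheory.measureReal_def, uniformOn_univ, MeasureTheory.Measure.count_apply_finite _
    (Set.toFinite _), ENNReal.toReal_div, uniformProb, Nat.card_eq_fintype_card (α := BoolFun n),
    ← Set.ncard_eq_toFinset_card, ← Nat.card_coe_set_eq]
  rfl

theorem uniformProb_mono {P Q : BoolFun n → Prop} (h : ∀ f, P f → Q f) :
    uniformProb P ≤ uniformProb Q := by
  simp only [uniformProb_eq_uniformOn_real]
  exact MeasureTheory.measureReal_mono h

theorem uniformProb_le_one (P : BoolFun n → Prop) : uniformProb P ≤ 1 := by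
  rw [uniformProb_eq_uniformOn_real]
  exact MeasureTheory.measureReal_le_one

theorem uniformProb_not (P : BoolFun n → Prop) :
    uniformProb (fun f => ¬ P f) = 1 - uniformProb P := by
  simp only [uniformProb_eq_uniformOn_real]
  exact MeasureTheory.probReal_compl_eq_one_sub (Set.toFinite _).measurableSet

theorem uniformProb_or_le (P Q : BoolFun n → Prop) :
    uniformProb (fun f => P f ∨ Q f) ≤ uniformProb P + uniformProb Q := by
  simp only [uniformProb_eq_uniformOn_real]
  exact MeasureTheory.measureReal_union_le _ _

theorem uniformProb_exists_le {ι : Type*} [Fintype ι] (P : ι → BoolFun n → Prop) :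
    uniformProb (fun f => ∃ i, P i f) ≤ ∑ i, uniformProb (P i) := by
  simp only [uniformProb_eq_uniformOn_real, Set.ofPred_exists]
  exact MeasureTheory.measureReal_iUnion_fintype_le _

theorem uniformProb_mem (A : Finset (BoolFun n)) :
    uniformProb (· ∈ A) = (#A : ℝ) / 2 ^ 2 ^ n := by
  simp [uniformProb]

theorem uniformProb_forall_mem_eq (T : Finset (Fin n → Bool)) (b : Bool) :
    uniformProb (fun f => ∀ z ∈ T, f z = b) = (1 / 2) ^ #T := by
  have mem_piFinset (f : BoolFun n) : (∀ z ∈ T, f z = b) ↔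
      f ∈ Fintype.piFinset fun z => if z ∈ T then {b} else univ := by
    simp only [Fintype.mem_piFinset]
    refine forall_congr' fun z => ?_
    split_ifs with hz <;> simp [hz]
  calc uniformProb (fun f => ∀ z ∈ T, f z = b)
      = (∏ z : Fin n → Bool, (#(if z ∈ T then {b} else univ : Finset Bool) : ℝ)) / 2 ^ 2 ^ n := by
        simp only [mem_piFinset, uniformProb_mem, Fintype.card_piFinset, Nat.cast_prod]
    _ = ∏ z : Fin n → Bool, (#(if z ∈ T then {b} else univ : Finset Bool) : ℝ) / 2 := by
        simp [Finset.prod_div_distrib]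
    _ = ∏ z : Fin n → Bool, if z ∈ T then 1 / 2 else 1 :=
        Finset.prod_congr rfl fun z _ => by split_ifs <;> simp
    _ = (1 / 2) ^ #T := by rw [Fintype.prod_ite_mem, Finset.prod_const]

end Probability

namespace WithHighProbability

variable {P Q : (n : ℕ) → BoolFun n → Prop}

theorem mono (hP : WithHighProbability P) (h : ∀ᶠ n in atTop, ∀ f, P n f → Q n f) :
    WithHighProbability Q :=
  tendsto_of_tendsto_of_tendsto_of_le_of_le' hP tendsto_const_nhds
    (h.mono fun _ => uniformProb_mono) (.of_forall fun n => uniformProb_le_one (Q n))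

theorem of_uniformProb_not_le {b : ℕ → ℝ} (hb : Tendsto b atTop (𝓝 0))
    (h : ∀ᶠ n in atTop, uniformProb (fun f => ¬ P n f) ≤ b n) : WithHighProbability P := by
  have hb' : Tendsto (fun n => 1 - b n) atTop (𝓝 1) := by simpa using hb.const_sub 1
  refine tendsto_of_tendsto_of_tendsto_of_le_of_le' hb' tendsto_const_nhds ?_
    (.of_forall fun n => uniformProb_le_one (P n))
  filter_upwards [h] with n hn
  rw [uniformProb_not] at hn
  linarith

theorem and (hP : WithHighProbability P) (hQ : WithHighProbability Q) :
    WithHighProbability fun n f => P n f ∧ Q n f := by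
  have h : Tendsto (fun n => (1 - uniformProb (P n)) + (1 - uniformProb (Q n))) atTop (𝓝 0) := by
    simpa using (hP.const_sub 1).add (hQ.const_sub 1)
  refine .of_uniformProb_not_le h (.of_forall fun n => ?_)
  simp only [not_and_or, ← uniformProb_not]
  exact uniformProb_or_le _ _

end WithHighProbability

section Subcubes

variable {n : ℕ}

/-- The subcube through `x` whose free coordinates are those in `S`; its dimension is `#S`. -/
def subcube (x : Fin n → Bool) (S : Finset (Fin n)) : Finset (Fin n → Bool) :=
  Fintype.piFinset fun i => if i ∈ S then univ else {x i}

theorem mem_subcube {x z : Fin n → Bool} {S : Finset (Fin n)} :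
    z ∈ subcube x S ↔ ∀ i ∉ S, z i = x i := by
  simp only [subcube, Fintype.mem_piFinset]
  refine forall_congr' fun i => ?_
  split_ifs with hi <;> simp [hi]

theorem card_subcube (x : Fin n → Bool) (S : Finset (Fin n)) : #(subcube x S) = 2 ^ #S := by
  simp [subcube, Fintype.card_piFinset, apply_ite Finset.card]

theorem subcube_mono (x : Fin n → Bool) {S T : Finset (Fin n)} (h : S ⊆ T) :
    subcube x S ⊆ subcube x T :=
  fun _ hz => mem_subcube.2 fun i hi => mem_subcube.1 hz i fun hS => hi (h hS)

theorem subcube_empty (x : Fin n → Bool) : subcube x ∅ = {x} := by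
  ext z
  simp [mem_subcube, funext_iff]

theorem subcube_univ (x : Fin n → Bool) : subcube x univ = univ := by
  ext z
  simp [mem_subcube]

/-- All monochromatic subcubes of `f` have dimension less than `m`. -/
def MonochromaticDimLT (f : BoolFun n) (m : ℕ) : Prop :=
  ∀ (x : Fin n → Bool) (S : Finset (Fin n)), (∀ z ∈ subcube x S, f z = f x) → #S < m

theorem MonochromaticDimLT.exists_apply_eq {f : BoolFun n} {m : ℕ}
    (hf : MonochromaticDimLT f m) (hm : m ≤ n) (b : Bool) : ∃ y, f y = b := by
  by_contra! h
  refine (hf (fun _ => false) univ fun z _ => ?_).not_ge (by simpa using hm)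
  rw [Bool.eq_not_of_ne (h _), Bool.eq_not_of_ne (h _)]

theorem uniformProb_not_monochromaticDimLT_le (m : ℕ) :
    uniformProb (fun f : BoolFun n => ¬ MonochromaticDimLT f m) ≤
      2 * 4 ^ n * (1 / 2) ^ 2 ^ m := by
  let Bad (i : (Fin n → Bool) × Finset (Fin n) × Bool) (f : BoolFun n) : Prop :=
    m ≤ #i.2.1 ∧ ∀ z ∈ subcube i.1 i.2.1, f z = i.2.2
  have bad_le (i) : uniformProb (Bad i) ≤ (1 / 2) ^ 2 ^ m := by
    obtain ⟨x, S, b⟩ := i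
    by_cases hm : m ≤ #S
    · calc uniformProb (Bad (x, S, b)) ≤ uniformProb fun f => ∀ z ∈ subcube x S, f z = b :=
            uniformProb_mono fun f hf => hf.2
        _ = (1 / 2) ^ 2 ^ #S := by rw [uniformProb_forall_mem_eq, card_subcube]
        _ ≤ (1 / 2) ^ 2 ^ m := pow_le_pow_of_le_one (by norm_num) (by norm_num)
            (Nat.pow_le_pow_right two_pos hm)
    · have : uniformProb (Bad (x, S, b)) = 0 := by simp [Bad, hm, uniformProb]
      rw [this]
      positivity
  calc uniformProb (fun f : BoolFun n => ¬ MonochromaticDimLT f m)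
      ≤ uniformProb fun f => ∃ i, Bad i f := by
        refine uniformProb_mono fun f hf => ?_
        simp only [MonochromaticDimLT, not_forall, not_lt] at hf
        obtain ⟨x, S, hS, hm⟩ := hf
        exact ⟨(x, S, f x), hm, hS⟩
    _ ≤ ∑ _i : (Fin n → Bool) × Finset (Fin n) × Bool, (1 / 2 : ℝ) ^ 2 ^ m :=
        (uniformProb_exists_le Bad).trans (Finset.sum_le_sum fun i _ => bad_le i)
    _ = 2 * 4 ^ n * (1 / 2) ^ 2 ^ m := by
        simp only [sum_const, card_univ, Fintype.card_prod, Fintype.card_pi, Fintype.card_bool,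
          prod_const, Fintype.card_fin, Fintype.card_finset, nsmul_eq_mul]
        push_cast
        rw [show (4 : ℝ) = 2 * 2 by norm_num, mul_pow]
        ring

theorem natCast_le_two_pow_ceil_logb (n : ℕ) : n ≤ 2 ^ ⌈logb 2 n⌉₊ := by
  exact_mod_cast Real.natCeil_logb_natCast 2 n ▸ Nat.le_pow_clog one_lt_two n

theorem whp_monochromaticDimLT :
    WithHighProbability fun n f => MonochromaticDimLT f (⌈logb 2 n⌉₊ + 2) := by
  have h : Tendsto (fun n : ℕ => 2 * (1 / 4 : ℝ) ^ n) atTop (𝓝 0) := by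
    simpa using (tendsto_pow_atTop_nhds_zero_of_lt_one (r := (1 / 4 : ℝ)) (by norm_num)
      (by norm_num)).const_mul 2
  refine .of_uniformProb_not_le h (.of_forall fun n => ?_)
  have hexp : 4 * n ≤ 2 ^ (⌈logb 2 n⌉₊ + 2) := by
    have := natCast_le_two_pow_ceil_logb n
    rw [pow_add]
    lia
  calc uniformProb (fun f : BoolFun n => ¬ MonochromaticDimLT f (⌈logb 2 n⌉₊ + 2))
      ≤ 2 * 4 ^ n * (1 / 2) ^ 2 ^ (⌈logb 2 n⌉₊ + 2) := uniformProb_not_monochromaticDimLT_le _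
    _ ≤ 2 * 4 ^ n * (1 / 2) ^ (4 * n) := by
        gcongr 2 * 4 ^ n * ?_
        exact pow_le_pow_of_le_one (by norm_num) (by norm_num) hexp
    _ = 2 * (1 / 4) ^ n := by
        rw [pow_mul, mul_assoc, ← mul_pow]
        norm_num

end Subcubes

section KleeneLogic

theorem Ternary.and_eq_true {a b : Ternary} :
    Ternary.and a b = some true ↔ a = some true ∧ b = some true := by
  rcases a with _ | _ | _ <;> rcases b with _ | _ | _ <;> simp [Ternary.and]

theorem Ternary.and_eq_false {a b : Ternary} :
    Ternary.and a b = some false ↔ a = some false ∨ b = some false := by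
  rcases a with _ | _ | _ <;> rcases b with _ | _ | _ <;> simp [Ternary.and]

theorem Ternary.or_eq_true {a b : Ternary} :
    Ternary.or a b = some true ↔ a = some true ∨ b = some true := by
  rcases a with _ | _ | _ <;> rcases b with _ | _ | _ <;> simp [Ternary.or]

theorem Ternary.or_eq_false {a b : Ternary} :
    Ternary.or a b = some false ↔ a = some false ∧ b = some false := by
  rcases a with _ | _ | _ <;> rcases b with _ | _ | _ <;> simp [Ternary.or]

variable {n : ℕ}

theorem mem_resolutions {x : Fin n → Ternary} {y : Fin n → Bool} :
    y ∈ resolutions x ↔ ∀ i, x i = none ∨ x i = some (y i) := Iff.rfl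

theorem resolutions_stable (y : Fin n → Bool) : resolutions (stable y) = {y} := by
  ext z
  simp [mem_resolutions, stable, funext_iff, eq_comm]

theorem resolutions_perturb (x y : Fin n → Bool) :
    resolutions (perturb x y) = subcube x {i | y i} := by
  ext z
  rw [mem_resolutions, mem_coe, mem_subcube]
  refine forall_congr' fun i => ?_
  rw [perturb, mem_filter_univ, @eq_comm _ (z i)]
  cases y i <;> simp

theorem resolutions_nonempty (x : Fin n → Ternary) : (resolutions x).Nonempty :=
  ⟨fun i => (x i).getD false, mem_resolutions.2 fun i => by cases x i <;> simp⟩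

theorem LessStable.refl (x : Fin n → Ternary) : LessStable x x := fun _ => .inr rfl

theorem LessStable.trans {x y z : Fin n → Ternary} (hxy : LessStable x y)
    (hyz : LessStable y z) : LessStable x z := fun i =>
  (hxy i).elim .inl fun h => h ▸ hyz i

theorem lessStable_update_none (x : Fin n → Ternary) (i : Fin n) :
    LessStable (Function.update x i none) x := fun j => by
  by_cases h : j = i <;> simp [h]

end KleeneLogic

section Extension

variable {n : ℕ} {f : BoolFun n}

theorem extension_eq_some {x : Fin n → Ternary} {b : Bool} :
    extension f x = some b ↔ ∀ y ∈ resolutions x, f y = b := by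
  obtain ⟨y, hy⟩ := resolutions_nonempty x
  have eq_of_forall (c : Bool) (h : ∀ z ∈ resolutions x, f z = c) :
      (∀ z ∈ resolutions x, f z = b) ↔ c = b :=
    ⟨fun hb => (h y hy).symm.trans (hb y hy), fun hcb z hz => (h z hz).trans hcb⟩
  rw [extension]
  split_ifs with h₀ h₁
  · simp [eq_of_forall _ h₀]
  · simp [eq_of_forall _ h₁]
  · cases b <;> simp [h₀, h₁]

theorem extension_stable (f : BoolFun n) (y : Fin n → Bool) :
    extension f (stable y) = some (f y) := by
  simp [extension_eq_some, resolutions_stable]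

theorem extension_eq_some_of_lessStable {p z : Fin n → Ternary} {b : Bool}
    (hp : extension f p = some b) (h : LessStable p z) : extension f z = some b :=
  extension_eq_some.2 fun y hy => extension_eq_some.1 hp y (h.trans hy)

theorem hazardDerivative_eq_false {x y : Fin n → Bool} :
    hazardDerivative f x y = false ↔ ∀ z ∈ subcube x {i | y i}, f z = f x := by
  rw [hazardDerivative, decide_eq_false_iff_not, ← ne_eq, Option.ne_none_iff_exists']
  simp only [extension_eq_some, resolutions_perturb, mem_coe]
  refine ⟨fun ⟨b, hb⟩ z hz => ?_, fun h => ⟨f x, h⟩⟩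
  rw [hb z hz, hb x (by simp [mem_subcube])]

theorem hazardDerivative_monotone (f : BoolFun n) (x : Fin n → Bool) :
    Monotone (hazardDerivative f x) := fun y z hyz => by
  have zero_of_zero (hz : hazardDerivative f x z = false) : hazardDerivative f x y = false :=
    hazardDerivative_eq_false.2 fun w hw => hazardDerivative_eq_false.1 hz w
      (subcube_mono x (monotone_filter_right _ fun i _ => Bool.le_iff_imp.1 (hyz i)) hw)
  cases hz : hazardDerivative f x z
  · exact (zero_of_zero hz).le
  · exact Bool.le_true _

theorem hazardDerivative_bot (f : BoolFun n) (x : Fin n → Bool) :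
    hazardDerivative f x ⊥ = false := by
  simp [hazardDerivative_eq_false, subcube_empty]

theorem hazardDerivative_top {x y : Fin n → Bool} (h : f y ≠ f x) :
    hazardDerivative f x ⊤ = true := by
  rw [← Bool.not_eq_false, hazardDerivative_eq_false]
  exact fun hconst => h (hconst y (by simp [subcube_univ]))

theorem exists_primeImplicate {z : Fin n → Ternary} (hz : extension f z = some false) :
    ∃ p ∈ primeImplicates f, LessStable p z := by
  obtain ⟨p, ⟨hp, hpz⟩, hmin⟩ := exists_minimalFor_of_wellFoundedLT
    (fun p => extension f p = some false ∧ LessStable p z)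
    (fun p => #{i | p i ≠ none}) ⟨z, hz, .refl z⟩
  refine ⟨p, ⟨hp, fun i hi => ?_⟩, hpz⟩
  by_contra hne
  obtain ⟨b, hb⟩ := Option.ne_none_iff_exists'.1 hne
  have hle := lessStable_update_none p i
  obtain rfl : b = false := by
    simpa [hp] using (extension_eq_some_of_lessStable hb hle).symm
  refine (hmin ⟨hb, hle.trans hpz⟩ (card_le_card fun j => ?_)).not_gt
    (card_lt_card ((ssubset_iff_of_subset fun j => ?_).2 ⟨i, by simpa using hi, by simp⟩))
  all_goals by_cases hj : j = i <;> simp [hj]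

theorem Covers.exists_mem {X : Finset (Fin n → Bool)} (hX : Covers f X) {z : Fin n → Ternary}
    (hz : extension f z = some false) :
    ∃ x ∈ X, f x = false ∧ ∀ w ∈ subcube x {i | z i ≠ some (x i)}, f w = false := by
  obtain ⟨p, hp, hpz⟩ := exists_primeImplicate hz
  obtain ⟨x, hx, -, hpx⟩ : ∃ x ∈ X, p ∈ primeImplicates f ∧ LessStable p (stable x) := by
    simpa only [Set.mem_iUnion, Set.mem_ofPred_eq, exists_prop] using hX.subset hp
  have hzero := extension_eq_some.1 hp.1
  refine ⟨x, hx, hzero x hpx, fun w hw => hzero w (mem_resolutions.2 fun i => ?_)⟩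
  rcases hpx i with hi | hi
  · exact .inl hi
  · refine (hpz i).imp_right fun hpzi => ?_
    have hw := mem_subcube.1 hw i
    simp_all [stable]

theorem covers_univ (f : BoolFun n) : Covers f univ := by
  ext p
  simp only [mem_univ, Set.iUnion_true, Set.mem_iUnion, Set.mem_ofPred_eq, exists_and_left]
  exact ⟨fun hp => ⟨hp, resolutions_nonempty p⟩, And.left⟩

end Extension

namespace Formula

variable {n : ℕ}

theorem exists_conjunction {ι : Type*} {s : Finset ι} (hs : s.Nonempty) (F : ι → Formula n) :
    ∃ G : Formula n, G.size = ∑ i ∈ s, (F i).size ∧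
      ((∀ i ∈ s, (F i).IsMonotone) → G.IsMonotone) ∧
      ∀ x, (G.eval x = some true ↔ ∀ i ∈ s, (F i).eval x = some true) ∧
        (G.eval x = some false ↔ ∃ i ∈ s, (F i).eval x = some false) := by
  classical
  induction hs using Finset.Nonempty.cons_induction with
  | singleton a => exact ⟨F a, by simp⟩
  | cons a s ha _ ih =>
    obtain ⟨G, hsize, hmono, heval⟩ := ih
    refine ⟨(F a).and G, by rw [size, hsize, sum_cons], fun h => ?_, fun x => ⟨?_, ?_⟩⟩
    · exact ⟨h a (by simp), hmono fun i hi => h i (by simp [hi])⟩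
    · simp [eval, Ternary.and_eq_true, (heval x).1]
    · simp [eval, Ternary.and_eq_false, (heval x).2]

theorem exists_disjunction {ι : Type*} {s : Finset ι} (hs : s.Nonempty) (F : ι → Formula n) :
    ∃ G : Formula n, G.size = ∑ i ∈ s, (F i).size ∧
      ((∀ i ∈ s, (F i).IsMonotone) → G.IsMonotone) ∧
      ∀ x, (G.eval x = some true ↔ ∃ i ∈ s, (F i).eval x = some true) ∧
        (G.eval x = some false ↔ ∀ i ∈ s, (F i).eval x = some false) := by
  classical
  induction hs using Finset.Nonempty.cons_induction with
  | singleton a => exact ⟨F a, by simp⟩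
  | cons a s ha _ ih =>
    obtain ⟨G, hsize, hmono, heval⟩ := ih
    refine ⟨(F a).or G, by rw [size, hsize, sum_cons], fun h => ?_, fun x => ⟨?_, ?_⟩⟩
    · exact ⟨h a (by simp), hmono fun i hi => h i (by simp [hi])⟩
    · simp [eval, Ternary.or_eq_true, (heval x).1]
    · simp [eval, Ternary.or_eq_false, (heval x).2]

theorem IsMonotone.eval_eq_true {F : Formula n} (hF : F.IsMonotone) (z : Fin n → Ternary) :
    F.eval z = some true ↔ F.eval (stable fun i => decide (z i = some true)) = some true := by
  induction F with
  | var i => simp [eval, stable]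
  | not F => exact hF.elim
  | and F G ihF ihG => simp only [eval, Ternary.and_eq_true, ihF hF.1, ihG hF.2]
  | or F G ihF ihG => simp only [eval, Ternary.or_eq_true, ihF hF.1, ihG hF.2]

theorem IsMonotone.eval_eq_false {F : Formula n} (hF : F.IsMonotone) (z : Fin n → Ternary) :
    F.eval z = some false ↔ F.eval (stable fun i => decide (z i ≠ some false)) = some false := by
  induction F with
  | var i => simp [eval, stable]
  | not F => exact hF.elim
  | and F G ihF ihG => simp only [eval, Ternary.and_eq_false, ihF hF.1, ihG hF.2]
  | or F G ihF ihG => simp only [eval, Ternary.or_eq_false, ihF hF.1, ihG hF.2]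

/-- The formula for `z ↦ F (x ⊕ z)`, which negates the variables `i` with `x i = true`. It turns
formulas for the hazard-derivative `df(x; ·)` into formulas describing `f` as seen from `x`. -/
def shift (x : Fin n → Bool) : Formula n → Formula n
  | var i => if x i then not (var i) else var i
  | not F => not (F.shift x)
  | and F G => and (F.shift x) (G.shift x)
  | or F G => or (F.shift x) (G.shift x)

theorem size_shift (x : Fin n → Bool) (F : Formula n) : (F.shift x).size = F.size := by
  induction F with
  | var i => rw [shift]; split_ifs <;> rfl
  | not _ ih => exact ih
  | and F G hF hG => simp [shift, size, hF, hG]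
  | or F G hF hG => simp [shift, size, hF, hG]

theorem eval_shift (x : Fin n → Bool) (z : Fin n → Ternary) (F : Formula n) :
    (F.shift x).eval z = F.eval fun i => if x i then Ternary.not (z i) else z i := by
  induction F with
  | var i => rw [shift]; split_ifs with h <;> simp [eval, h]
  | not F ih => simp [shift, eval, ih]
  | and F G hF hG => simp [shift, eval, hF, hG]
  | or F G hF hG => simp [shift, eval, hF, hG]

variable {f : BoolFun n} {x : Fin n → Bool} {F : Formula n}

theorem eval_shift_eq_false (hF : F.Computes (hazardDerivative f x)) (hmono : F.IsMonotone)
    (z : Fin n → Ternary) :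
    (F.shift x).eval z = some false ↔
      ∀ w ∈ subcube x {i | z i ≠ some (x i)}, f w = f x := by
  have free_iff (i : Fin n) :
      (if x i then Ternary.not (z i) else z i) ≠ some false ↔ z i ≠ some (x i) := by
    rcases z i with _ | _ | _ <;> cases x i <;> simp [Ternary.not]
  simp only [eval_shift, hmono.eval_eq_false, hF _, Option.some.injEq, hazardDerivative_eq_false,
    decide_eq_true_eq, free_iff]

theorem eval_shift_eq_true (hF : F.Computes (hazardDerivative f x)) (hmono : F.IsMonotone)
    (z : Fin n → Ternary) :
    (F.shift x).eval z = some true ↔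
      ∃ w ∈ subcube x {i | z i = some (!x i)}, f w ≠ f x := by
  have free_iff (i : Fin n) :
      (if x i then Ternary.not (z i) else z i) = some true ↔ z i = some (!x i) := by
    rcases z i with _ | _ | _ <;> cases x i <;> simp [Ternary.not]
  rw [eval_shift, hmono.eval_eq_true, hF, Option.some.injEq, ← Bool.not_eq_false,
    hazardDerivative_eq_false]
  simp only [decide_eq_true_eq, free_iff, not_forall, exists_prop]

theorem computes_and_isHazardFree_of_extension
    (h : ∀ z b, extension f z = some b → F.eval z = some b) :
    F.Computes f ∧ F.IsHazardFree := by
  have computes : F.Computes f := fun y => h _ _ (extension_stable f y)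
  refine ⟨computes, fun z ⟨hz, b, hb⟩ => ?_⟩
  have hext : extension f z = some b :=
    extension_eq_some.2 fun y hy => Option.some.inj ((computes y).symm.trans (hb y hy))
  simp [h z b hext] at hz

theorem exists_isHazardFree_of_covers {X : Finset (Fin n → Bool)} (hX : Covers f X)
    (hf : ∃ y, f y = false) {F : (Fin n → Bool) → Formula n}
    (hF : ∀ x ∈ X, (F x).Computes (hazardDerivative f x)) (hmono : ∀ x ∈ X, (F x).IsMonotone) :
    ∃ G : Formula n, (G.Computes f ∧ G.IsHazardFree) ∧
      G.size = ∑ x ∈ X with f x = false, (F x).size := by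
  have hne : ({x ∈ X | f x = false} : Finset _).Nonempty := by
    obtain ⟨y, hy⟩ := hf
    obtain ⟨x, hx, hfx, -⟩ := hX.exists_mem ((extension_stable f y).trans (congrArg some hy))
    exact ⟨x, mem_filter.2 ⟨hx, hfx⟩⟩
  obtain ⟨G, hsize, -, hG⟩ := exists_conjunction hne fun x => (F x).shift x
  refine ⟨G, computes_and_isHazardFree_of_extension fun z b hz => ?_, by
    simpa only [size_shift] using hsize⟩
  cases b
  · obtain ⟨x, hx, hfx, hzero⟩ := hX.exists_mem hz
    refine (hG z).2.2 ⟨x, mem_filter.2 ⟨hx, hfx⟩, ?_⟩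
    exact (eval_shift_eq_false (hF x hx) (hmono x hx) z).2 fun w hw => (hzero w hw).trans hfx.symm
  · refine (hG z).1.2 fun x hx => ?_
    obtain ⟨hx, hfx⟩ := mem_filter.1 hx
    -- The resolution of `z` that agrees with `x` wherever `z` is unstable.
    let w : Fin n → Bool := fun i => (z i).getD (x i)
    have hw : f w = true := extension_eq_some.1 hz w <| mem_resolutions.2 fun i => by
      cases hi : z i <;> simp [w, hi]
    refine (eval_shift_eq_true (hF x hx) (hmono x hx) z).2 ⟨w, mem_subcube.2 fun i hi => ?_, ?_⟩
    · cases hzi : z i <;> simp_all [w]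
    · simp [hw, hfx]

end Formula

section SizeMeasures

variable {n : ℕ} {f : BoolFun n}

theorem exists_natCast_eq_biInf {α : Type*} {P : α → Prop} {s : α → ℕ}
    (h : ⨅ (a) (_ : P a), (s a : ℕ∞) ≠ ⊤) :
    ∃ a, P a ∧ (s a : ℕ∞) = ⨅ (a) (_ : P a), (s a : ℕ∞) := by
  rw [iInf_subtype'] at h ⊢
  have : Nonempty {a // P a} := by
    by_contra hempty
    rw [not_nonempty_iff] at hempty
    exact h (by simp)
  obtain ⟨⟨a, ha⟩, hmin⟩ := ciInf_mem fun a : {a // P a} => (s a : ℕ∞)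
  exact ⟨a, ha, hmin⟩

theorem hazardFreeSize_le_derivativeSum {X : Finset (Fin n → Bool)} (hX : Covers f X)
    (hf : ∃ y, f y = false) : hazardFreeSize f ≤ derivativeSum f X := by
  by_cases hfin : ∀ x ∈ X, monotoneSize (hazardDerivative f x) ≠ ⊤
  · have optimal (x) (hx : x ∈ X) := exists_natCast_eq_biInf (hfin x hx)
    have : Nonempty (Formula n) := by
      obtain ⟨y, hy⟩ := hf
      obtain ⟨x, hx, -⟩ := hX.exists_mem ((extension_stable f y).trans (congrArg some hy))
      exact ⟨(optimal x hx).choose⟩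
    choose! F hF hsize using optimal
    obtain ⟨G, hG, hGsize⟩ := Formula.exists_isHazardFree_of_covers hX hf
      (fun x hx => (hF x hx).1) (fun x hx => (hF x hx).2)
    calc hazardFreeSize f ≤ G.size := iInf₂_le G hG
      _ ≤ ∑ x ∈ X, ((F x).size : ℕ∞) := by
        rw [hGsize, Nat.cast_sum]
        exact sum_le_sum_of_subset (filter_subset _ _)
      _ = derivativeSum f X := sum_congr rfl hsize
  · push Not at hfin
    obtain ⟨x, hx, htop⟩ := hfin
    have hsum : derivativeSum f X = ⊤ := WithTop.sum_eq_top.2 ⟨x, hx, htop⟩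
    exact hsum ▸ le_top

end SizeMeasures

namespace Formula

variable {n : ℕ}

theorem size_pos (F : Formula n) : 0 < F.size := by
  induction F with
  | var => exact Nat.one_pos
  | not _ ih => exact ih
  | and F G hF _ => exact Nat.add_pos_left hF _
  | or F G hF _ => exact Nat.add_pos_left hF _

/-- The Boolean function computed by a formula. -/
def boolEval : Formula n → BoolFun n
  | var i => fun y => y i
  | not F => fun y => !F.boolEval y
  | and F G => fun y => F.boolEval y && G.boolEval y
  | or F G => fun y => F.boolEval y || G.boolEval y

theorem eval_stable (F : Formula n) (y : Fin n → Bool) :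
    F.eval (stable y) = some (F.boolEval y) := by
  induction F with
  | var i => rfl
  | not F ih => simp [eval, ih, Ternary.not, boolEval]
  | and F G hF hG =>
    simp only [eval, hF, hG, boolEval]
    cases F.boolEval y <;> cases G.boolEval y <;> rfl
  | or F G hF hG =>
    simp only [eval, hF, hG, boolEval]
    cases F.boolEval y <;> cases G.boolEval y <;> rfl

theorem Computes.boolEval_eq {F : Formula n} {f : BoolFun n} (hF : F.Computes f) :
    F.boolEval = f :=
  funext fun y => Option.some.inj ((F.eval_stable y).symm.trans (hF y))

theorem exists_boolEval_eq_literal {F : Formula n} (hF : F.size = 1) :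
    ∃ (i : Fin n) (b : Bool), F.boolEval = fun y => xor (y i) b := by
  induction F with
  | var i => exact ⟨i, false, by simp [boolEval]⟩
  | not F ih =>
    obtain ⟨i, b, h⟩ := ih hF
    exact ⟨i, !b, by simp [boolEval, h]⟩
  | and F G =>
    have := F.size_pos
    have := G.size_pos
    simp only [size] at hF
    lia
  | or F G =>
    have := F.size_pos
    have := G.size_pos
    simp only [size] at hF
    lia

theorem exists_boolEval_eq_and_or {F : Formula n} (hF : 2 ≤ F.size) :
    ∃ G H : Formula n, G.size + H.size = F.size ∧
      (F.boolEval = (fun y => G.boolEval y && H.boolEval y) ∨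
        F.boolEval = fun y => G.boolEval y || H.boolEval y) := by
  induction F with
  | var i => simp [size] at hF
  | not F ih =>
    -- De Morgan: the negation is pushed to the two subformulas.
    obtain ⟨G, H, hsize, h | h⟩ := ih hF
    · exact ⟨G.not, H.not, hsize, .inr (by simp [boolEval, h])⟩
    · exact ⟨G.not, H.not, hsize, .inl (by simp [boolEval, h])⟩
  | and F G => exact ⟨F, G, rfl, .inl rfl⟩
  | or F G => exact ⟨F, G, rfl, .inr rfl⟩

end Formula

section Counting

variable {n : ℕ}

open Classical in
/-- The Boolean functions that have a formula with exactly `s` leaves. -/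
noncomputable def functionsOfSize (n s : ℕ) : Finset (BoolFun n) :=
  {f | ∃ F : Formula n, F.size = s ∧ F.boolEval = f}

theorem mem_functionsOfSize {s : ℕ} {f : BoolFun n} :
    f ∈ functionsOfSize n s ↔ ∃ F : Formula n, F.size = s ∧ F.boolEval = f := by
  simp [functionsOfSize]

theorem functionsOfSize_zero : functionsOfSize n 0 = ∅ :=
  eq_empty_of_forall_notMem fun f hf => by
    obtain ⟨F, hF, -⟩ := mem_functionsOfSize.1 hf
    exact F.size_pos.ne' hF

theorem card_functionsOfSize_one_le : #(functionsOfSize n 1) ≤ 2 * n := by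
  have hsub : functionsOfSize n 1 ⊆ univ.image fun (p : Fin n × Bool) y => xor (y p.1) p.2 := by
    intro f hf
    obtain ⟨F, hF, rfl⟩ := mem_functionsOfSize.1 hf
    obtain ⟨i, b, h⟩ := Formula.exists_boolEval_eq_literal hF
    exact mem_image.2 ⟨(i, b), mem_univ _, h.symm⟩
  exact (card_le_card hsub).trans (card_image_le.trans_eq (by simp [mul_comm]))

theorem card_functionsOfSize_add_two_le (s : ℕ) :
    #(functionsOfSize n (s + 2)) ≤ ∑ ij ∈ antidiagonal s,
      2 * (#(functionsOfSize n (ij.1 + 1)) * #(functionsOfSize n (ij.2 + 1))) := by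
  classical
  let combine (c : Bool → Bool → Bool) (ij : ℕ × ℕ) : Finset (BoolFun n) :=
    image₂ (fun g h y => c (g y) (h y)) (functionsOfSize n (ij.1 + 1))
      (functionsOfSize n (ij.2 + 1))
  have hsub : functionsOfSize n (s + 2) ⊆
      (antidiagonal s).biUnion fun ij => combine and ij ∪ combine or ij := by
    intro f hf
    obtain ⟨F, hF, rfl⟩ := mem_functionsOfSize.1 hf
    obtain ⟨G, H, hsize, h⟩ := Formula.exists_boolEval_eq_and_or (F := F) (by lia)
    have hG := G.size_pos
    have hH := H.size_pos
    have hG' : G.boolEval ∈ functionsOfSize n (G.size - 1 + 1) :=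
      mem_functionsOfSize.2 ⟨G, by lia, rfl⟩
    have hH' : H.boolEval ∈ functionsOfSize n (H.size - 1 + 1) :=
      mem_functionsOfSize.2 ⟨H, by lia, rfl⟩
    refine mem_biUnion.2 ⟨(G.size - 1, H.size - 1), mem_antidiagonal.2 (by lia), ?_⟩
    rcases h with h | h
    · exact mem_union_left _ (h ▸ mem_image₂_of_mem hG' hH')
    · exact mem_union_right _ (h ▸ mem_image₂_of_mem hG' hH')
  refine (card_le_card hsub).trans (card_biUnion_le.trans (sum_le_sum fun ij _ => ?_))
  rw [two_mul]
  exact (card_union_le _ _).trans (add_le_add (card_image₂_le ..) (card_image₂_le ..))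

theorem card_functionsOfSize_le_catalan (s : ℕ) :
    #(functionsOfSize n (s + 1)) ≤ catalan s * 2 ^ s * (2 * n) ^ (s + 1) := by
  induction s using Nat.strong_induction_on with
  | _ s ih =>
    rcases s with _ | s
    · simpa using card_functionsOfSize_one_le
    · calc #(functionsOfSize n (s + 2))
          ≤ ∑ ij ∈ antidiagonal s,
              2 * (#(functionsOfSize n (ij.1 + 1)) * #(functionsOfSize n (ij.2 + 1))) :=
            card_functionsOfSize_add_two_le s
        _ ≤ ∑ ij ∈ antidiagonal s, catalan ij.1 * catalan ij.2 *
              2 ^ (s + 1) * (2 * n) ^ (s + 2) := by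
            refine sum_le_sum fun ij hij => ?_
            obtain rfl := mem_antidiagonal.1 hij
            calc _ ≤ 2 * ((catalan ij.1 * 2 ^ ij.1 * (2 * n) ^ (ij.1 + 1)) *
                  (catalan ij.2 * 2 ^ ij.2 * (2 * n) ^ (ij.2 + 1))) := by
                  gcongr
                  exacts [ih _ (by lia), ih _ (by lia)]
              _ = _ := by ring
        _ = catalan (s + 1) * 2 ^ (s + 1) * (2 * n) ^ (s + 2) := by
            rw [catalan_succ', sum_mul, sum_mul]

theorem catalan_le_four_pow (s : ℕ) : catalan s ≤ 4 ^ s :=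
  calc catalan s ≤ (s + 1) * catalan s := Nat.le_mul_of_pos_left _ s.succ_pos
    _ = s.centralBinom := succ_mul_catalan_eq_centralBinom s
    _ ≤ 4 ^ s := Nat.centralBinom_le_four_pow s

theorem card_functionsOfSize_le (n s : ℕ) : #(functionsOfSize n s) ≤ (16 * n) ^ s := by
  rcases s with _ | s
  · simp [functionsOfSize_zero]
  · calc #(functionsOfSize n (s + 1)) ≤ catalan s * 2 ^ s * (2 * n) ^ (s + 1) :=
          card_functionsOfSize_le_catalan s
      _ ≤ 4 ^ (s + 1) * 2 ^ (s + 1) * (2 * n) ^ (s + 1) := by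
          gcongr ?_ * ?_ * _
          · exact (catalan_le_four_pow s).trans (Nat.pow_le_pow_right four_pos s.le_succ)
          · exact Nat.pow_le_pow_right two_pos s.le_succ
      _ = (16 * n) ^ (s + 1) := by
          rw [← mul_pow, ← mul_pow]
          ring_nf

theorem exists_computes_size_le_of_hazardFreeSize_lt {f : BoolFun n} {r : ℝ}
    (h : (hazardFreeSize f : ℝ≥0∞) < ENNReal.ofReal r) :
    ∃ F : Formula n, F.Computes f ∧ F.size ≤ ⌊r⌋₊ := by
  have hfin : hazardFreeSize f ≠ ⊤ := fun htop => by simp [htop] at h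
  obtain ⟨F, hF, hsize⟩ := exists_natCast_eq_biInf hfin
  refine ⟨F, hF.1, Nat.le_floor ?_⟩
  change _ = hazardFreeSize f at hsize
  rw [← hsize, ENat.toENNReal_coe, ← ENNReal.ofReal_natCast] at h
  exact (ENNReal.ofReal_lt_ofReal_iff'.1 h).1.le

theorem uniformProb_hazardFreeSize_lt_le (hn : 0 < n) (r : ℝ) :
    uniformProb (fun f : BoolFun n => (hazardFreeSize f : ℝ≥0∞) < ENNReal.ofReal r) ≤
      (16 * n : ℝ) ^ (⌊r⌋₊ + 1) / 2 ^ 2 ^ n := by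
  classical
  let A : Finset (BoolFun n) := (range (⌊r⌋₊ + 1)).biUnion (functionsOfSize n)
  have card_A_le : #A ≤ (16 * n) ^ (⌊r⌋₊ + 1) :=
    calc #A ≤ ∑ s ∈ range (⌊r⌋₊ + 1), (16 * n) ^ s :=
          card_biUnion_le.trans (sum_le_sum fun s _ => card_functionsOfSize_le n s)
      _ ≤ (16 * n) ^ (⌊r⌋₊ + 1) :=
          (Nat.geomSum_lt (by lia) fun _ => mem_range.1).le
  calc uniformProb (fun f : BoolFun n => (hazardFreeSize f : ℝ≥0∞) < ENNReal.ofReal r)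
      ≤ uniformProb (· ∈ A) := by
        refine uniformProb_mono fun f hf => ?_
        obtain ⟨F, hF, hsize⟩ := exists_computes_size_le_of_hazardFreeSize_lt hf
        exact mem_biUnion.2 ⟨F.size, mem_range.2 (by lia),
          mem_functionsOfSize.2 ⟨F, rfl, hF.boolEval_eq⟩⟩
    _ = #A / 2 ^ 2 ^ n := uniformProb_mem A
    _ ≤ (16 * n : ℝ) ^ (⌊r⌋₊ + 1) / 2 ^ 2 ^ n := by
        gcongr
        exact_mod_cast card_A_le

end Counting

section LowerBound

theorem tendsto_logb_natCast : Tendsto (fun n : ℕ => logb 2 n) atTop atTop :=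
  (Real.tendsto_logb_atTop one_lt_two).comp tendsto_natCast_atTop_atTop

theorem tendsto_logb_natCast_pow_div (k : ℕ) :
    Tendsto (fun n : ℕ => logb 2 n ^ k / n) atTop (𝓝 0) :=
  (Real.isLittleO_pow_logb_id_atTop.tendsto_div_nhds_zero).comp tendsto_natCast_atTop_atTop

theorem two_rpow_logb_natCast {n : ℕ} (hn : 0 < n) : (2 : ℝ) ^ logb 2 n = n :=
  Real.rpow_logb two_pos (by norm_num) (by exact_mod_cast hn)

theorem uniformProb_hazardFreeSize_lt_le_two_rpow {n : ℕ} (hn : 0 < n) {r : ℝ} (hr : 0 ≤ r) :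
    uniformProb (fun f : BoolFun n => (hazardFreeSize f : ℝ≥0∞) < ENNReal.ofReal r) ≤
      2 ^ ((4 + logb 2 n) * (r + 1) - 2 ^ n : ℝ) := by
  have hbase : (16 * n : ℝ) = 2 ^ (4 + logb 2 n) := by
    rw [Real.rpow_add two_pos, two_rpow_logb_natCast hn]
    norm_num
  have hlog : 0 ≤ logb 2 n := Real.logb_nonneg one_lt_two (by exact_mod_cast hn)
  calc uniformProb (fun f : BoolFun n => (hazardFreeSize f : ℝ≥0∞) < ENNReal.ofReal r)
      ≤ (16 * n : ℝ) ^ (⌊r⌋₊ + 1) / 2 ^ 2 ^ n := uniformProb_hazardFreeSize_lt_le hn r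
    _ = 2 ^ ((4 + logb 2 n) * (⌊r⌋₊ + 1) - 2 ^ n : ℝ) := by
        rw [Real.rpow_sub two_pos, Real.rpow_mul two_pos.le, ← hbase]
        norm_cast
    _ ≤ 2 ^ ((4 + logb 2 n) * (r + 1) - 2 ^ n : ℝ) := by
        gcongr
        exacts [one_le_two, Nat.floor_le hr]

theorem tendsto_countingExponent {ε : ℝ} (hε : 0 < ε) :
    Tendsto (fun n : ℕ => (4 + logb 2 n) * ((1 - ε) * 2 ^ n / logb 2 n + 1) - 2 ^ n)
      atTop atBot := by
  have hpow : Tendsto (fun n : ℕ => (2 : ℝ) ^ n) atTop atTop :=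
    tendsto_pow_atTop_atTop_of_one_lt one_lt_two
  have hinv : Tendsto (fun n : ℕ => 4 / logb 2 n) atTop (𝓝 0) :=
    tendsto_logb_natCast.const_div_atTop 4
  have hlog : Tendsto (fun n : ℕ => logb 2 n / 2 ^ n) atTop (𝓝 0) := by
    have h := (tendsto_logb_natCast_pow_div 1).mul
      (tendsto_pow_const_div_const_pow_of_one_lt 1 (one_lt_two (α := ℝ)))
    rw [mul_zero] at h
    refine h.congr' ?_
    filter_upwards [eventually_gt_atTop 0] with n hn
    field_simp
  have hlim : Tendsto (fun n : ℕ => (1 - ε) * (4 / logb 2 n + 1) - 1 +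
      (4 / 2 ^ n + logb 2 n / 2 ^ n)) atTop (𝓝 (-ε)) := by
    have h := ((hinv.add_const 1).const_mul (1 - ε)).sub_const 1 |>.add
      ((hpow.const_div_atTop 4).add hlog)
    convert h using 2
    ring
  refine (hpow.atTop_mul_neg (neg_neg_of_pos hε) hlim).congr' ?_
  filter_upwards [tendsto_logb_natCast.eventually_gt_atTop 0] with n hL
  field_simp
  ring

theorem whp_le_hazardFreeSize {ε : ℝ} (hε : 0 < ε) :
    WithHighProbability fun n f =>
      ENNReal.ofReal ((1 - ε) * 2 ^ n / logb 2 n) ≤ (hazardFreeSize f : ℝ≥0∞) := by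
  wlog hε₁ : ε ≤ 1 generalizing ε
  · refine (this one_pos le_rfl).mono ?_
    filter_upwards [tendsto_logb_natCast.eventually_ge_atTop 0] with n hL f hf
    refine le_trans (ENNReal.ofReal_le_ofReal ?_) hf
    gcongr
    exact (not_le.1 hε₁).le
  refine .of_uniformProb_not_le
    ((tendsto_rpow_atBot_of_base_gt_one 2 one_lt_two).comp (tendsto_countingExponent hε)) ?_
  filter_upwards [eventually_gt_atTop 0, tendsto_logb_natCast.eventually_ge_atTop 0] with n hn hL
  have hr : 0 ≤ (1 - ε) * 2 ^ n / logb 2 n :=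
    div_nonneg (mul_nonneg (sub_nonneg.2 hε₁) (by positivity)) hL
  simp only [not_le]
  exact uniformProb_hazardFreeSize_lt_le_two_rpow hn hr

end LowerBound

section DerivativeSize

variable {n : ℕ} {f : BoolFun n}

open Classical in
theorem monotoneSize_le_of_monotone {g : BoolFun n} (hg : Monotone g) (hbot : g ⊥ = false)
    (htop : g ⊤ = true) : monotoneSize g ≤ (n * #{y | g y = false} : ℕ) := by
  have hclause (y : Fin n → Bool) (hy : g y = false) : ∃ G : Formula n,
      G.size ≤ n ∧ G.IsMonotone ∧ ∀ z, (G.eval z = some true ↔ ∃ i, y i = false ∧ z i = some true) ∧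
        (G.eval z = some false ↔ ∀ i, y i = false → z i = some false) := by
    have hne : ({i | y i = false} : Finset (Fin n)).Nonempty := by
      contrapose! htop
      have : y = ⊤ := by
        ext i
        simpa using (Finset.filter_eq_empty_iff.1 htop) (mem_univ i)
      simp [← this, hy]
    obtain ⟨G, hsize, hmono, heval⟩ := Formula.exists_disjunction hne Formula.var
    refine ⟨G, ?_, hmono fun i _ => trivial, fun z => by simpa [Formula.eval] using heval z⟩
    simpa [hsize, Formula.size] using card_le_univ ({i | y i = false} : Finset (Fin n))
  have : Nonempty (Formula n) := ⟨(hclause ⊥ hbot).choose⟩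
  choose! G hsize hmono heval using hclause
  obtain ⟨H, hHsize, hHmono, hHeval⟩ :=
    Formula.exists_conjunction (s := {y | g y = false}) ⟨⊥, by simpa using hbot⟩ G
  have hH : H.Computes g := by
    intro z
    rcases hz : g z with _ | _
    · refine (hHeval _).2.2 ⟨z, by simpa using hz, ((heval z hz _).2).2 fun i hi => ?_⟩
      simp [stable, hi]
    · refine (hHeval _).1.2 fun y hy => ?_
      rw [mem_filter_univ] at hy
      refine ((heval y hy _).1).2 ?_
      by_contra! h
      have hzy : z ≤ y := fun i => by
        rcases hyi : y i with _ | _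
        · have hzi : z i = false := by simpa [stable] using h i hyi
          exact hzi.le
        · exact le_top
      exact absurd (hg hzy) (by simp [hz, hy])
  refine (iInf₂_le H ⟨hH, hHmono fun y hy => hmono y (by simpa using hy)⟩).trans ?_
  rw [hHsize, mul_comm]
  exact_mod_cast sum_le_card_nsmul _ _ _ fun y hy => hsize y (by simpa using hy)

theorem card_hazardDerivative_eq_false_le {m : ℕ} (hf : MonochromaticDimLT f m)
    (x : Fin n → Bool) :
    #{y | hazardDerivative f x y = false} ≤ #{S : Finset (Fin n) | #S < m} := by
  refine card_le_card_of_injOn (fun y => ({i | y i} : Finset (Fin n))) (fun y hy => ?_)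
    fun y _ z _ hyz => ?_
  · rw [mem_coe, mem_filter_univ, hazardDerivative_eq_false] at hy
    simpa using hf x _ hy
  · ext i
    simpa using Finset.ext_iff.1 hyz i

theorem monotoneSize_hazardDerivative_le {m : ℕ} (hf : MonochromaticDimLT f m) (hm : m ≤ n)
    (x : Fin n → Bool) :
    monotoneSize (hazardDerivative f x) ≤ (n * #{S : Finset (Fin n) | #S < m} : ℕ) := by
  obtain ⟨y, hy⟩ := hf.exists_apply_eq hm (!f x)
  refine (monotoneSize_le_of_monotone (hazardDerivative_monotone f x) (hazardDerivative_bot f x)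
    (hazardDerivative_top (y := y) (by simp [hy]))).trans ?_
  gcongr
  convert card_hazardDerivative_eq_false_le hf x

theorem derivativeSum_le {m : ℕ} (hf : MonochromaticDimLT f m) (hm : m ≤ n)
    (X : Finset (Fin n → Bool)) :
    derivativeSum f X ≤ (2 ^ n * (n * #{S : Finset (Fin n) | #S < m}) : ℕ) := by
  have hX : #X ≤ 2 ^ n := by simpa using card_le_univ X
  calc derivativeSum f X
      ≤ #X • ((n * #{S : Finset (Fin n) | #S < m} : ℕ) : ℕ∞) :=
        sum_le_card_nsmul X _ _ fun x _ => monotoneSize_hazardDerivative_le hf hm x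
    _ ≤ (2 ^ n * (n * #{S : Finset (Fin n) | #S < m}) : ℕ) := by
        rw [nsmul_eq_mul]
        exact_mod_cast Nat.mul_le_mul_right _ hX

end DerivativeSize

theorem card_finset_card_le_le {α : Type*} [Fintype α] {k : ℕ} (hk : 0 < k)
    (hkα : k ≤ Fintype.card α) :
    (#{S : Finset α | #S ≤ k} : ℝ) ≤ (Real.exp 1 * Fintype.card α / k) ^ k := by
  have hα : (0 : ℝ) < Fintype.card α := by exact_mod_cast hk.trans_le hkα
  set q : ℝ := k / Fintype.card α with hq
  have hq_pos : 0 < q := div_pos (by exact_mod_cast hk) hα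
  have hq_le : q ≤ 1 := (div_le_one hα).2 (by exact_mod_cast hkα)
  have hweight : #{S : Finset α | #S ≤ k} * q ^ k ≤ (q + 1) ^ Fintype.card α := by
    rw [← Fintype.sum_pow_mul_eq_add_pow, ← nsmul_eq_mul]
    refine (card_nsmul_le_sum _ _ _ fun S hS => ?_).trans
      (sum_le_univ_sum_of_nonneg fun S => by positivity)
    rw [one_pow, mul_one]
    exact pow_le_pow_of_le_one hq_pos.le hq_le (mem_filter.1 hS).2
  calc (#{S : Finset α | #S ≤ k} : ℝ) ≤ (q + 1) ^ Fintype.card α / q ^ k :=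
        (le_div_iff₀ (by positivity)).2 hweight
    _ ≤ Real.exp q ^ Fintype.card α / q ^ k := by
        gcongr
        exact Real.add_one_le_exp q
    _ = (Real.exp 1 / q) ^ k := by
        rw [div_pow (Real.exp 1), ← Real.exp_nat_mul, ← Real.exp_nat_mul, mul_one, hq,
          mul_div_cancel₀ _ hα.ne']
    _ = (Real.exp 1 * Fintype.card α / k) ^ k := by rw [hq, div_div_eq_mul_div]

section UpperBound

theorem natCast_rpow_eq_two_rpow {n : ℕ} (hn : 0 < n) (c : ℝ) :
    (n : ℝ) ^ c = 2 ^ (logb 2 n * c) := by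
  rw [Real.rpow_mul two_pos.le, two_rpow_logb_natCast hn]

theorem logb_natCast_rpow_mul {n : ℕ} (hn : 0 < n) (hL : 0 < logb 2 n) (c : ℝ) :
    logb 2 n ^ (c * logb 2 n) = (n : ℝ) ^ (c * logb 2 (logb 2 n)) := by
  rw [natCast_rpow_eq_two_rpow hn]
  nth_rewrite 1 [← Real.rpow_logb two_pos (by norm_num) hL]
  rw [← Real.rpow_mul two_pos.le]
  ring_nf

theorem logb_natCast_le (n : ℕ) : logb 2 n ≤ n := by
  rcases n.eq_zero_or_pos with rfl | hn
  · simp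
  · rw [Real.logb_le_iff_le_rpow one_lt_two (by exact_mod_cast hn), Real.rpow_natCast]
    exact_mod_cast Nat.lt_two_pow_self.le

theorem eventually_ceil_logb_add_two_le : ∀ᶠ n : ℕ in atTop, ⌈logb 2 n⌉₊ + 2 ≤ n := by
  filter_upwards [(tendsto_logb_natCast_pow_div 1).eventually_le_const one_half_pos,
    tendsto_logb_natCast.eventually_ge_atTop 0, eventually_ge_atTop 6] with n hn hL h6
  have hn6 : (6 : ℝ) ≤ n := by exact_mod_cast h6
  rw [pow_one, div_le_iff₀ (by linarith)] at hn
  have hceil := Nat.ceil_lt_add_one hL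
  have hle : (⌈logb 2 n⌉₊ + 2 : ℝ) ≤ n := by linarith
  exact_mod_cast hle

theorem exp_one_mul_div_pow_le {n k : ℕ} (hL : 4 ≤ logb 2 n) (hLk : logb 2 n ≤ k)
    (hkL : k ≤ logb 2 n + 2) :
    (Real.exp 1 * n / k) ^ k ≤ (n : ℝ) ^ (logb 2 n - logb 2 (logb 2 n) + 5) := by
  have hLn := logb_natCast_le n
  have hn : 0 < n := by exact_mod_cast (by linarith : (0 : ℝ) < n)
  have hl : 0 ≤ logb 2 (logb 2 n) := Real.logb_nonneg one_lt_two (by linarith)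
  have hbase : 4 * n / logb 2 n = 2 ^ (2 + logb 2 n - logb 2 (logb 2 n)) := by
    rw [Real.rpow_sub two_pos, Real.rpow_add two_pos, two_rpow_logb_natCast hn,
      Real.rpow_logb two_pos (by norm_num) (by linarith)]
    norm_num
  rw [natCast_rpow_eq_two_rpow hn]
  generalize logb 2 (logb 2 (n : ℝ)) = l at *
  generalize logb 2 (n : ℝ) = L at *
  have hL_pos : 0 < L := by linarith
  calc (Real.exp 1 * n / k) ^ k ≤ (4 * n / L) ^ k := by
        gcongr
        exact Real.exp_one_lt_d9.le.trans (by norm_num)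
    _ = (4 * n / L) ^ (k : ℝ) := (Real.rpow_natCast _ _).symm
    _ ≤ (4 * n / L) ^ (L + 2) :=
        Real.rpow_le_rpow_of_exponent_le ((one_le_div hL_pos).2 (by linarith)) hkL
    _ = 2 ^ ((2 + L - l) * (L + 2)) := by rw [hbase, Real.rpow_mul two_pos.le]
    _ ≤ 2 ^ (L * (L - l + 5)) := Real.rpow_le_rpow_of_exponent_le one_le_two (by linarith)

theorem two_pow_mul_card_le {n : ℕ} (hL : 4 ≤ logb 2 n) (hn : ⌈logb 2 n⌉₊ + 2 ≤ n) :
    ((2 ^ n * (n * #{S : Finset (Fin n) | #S < ⌈logb 2 n⌉₊ + 2}) : ℕ) : ℝ) ≤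
      2 ^ n * (n : ℝ) ^ (logb 2 n - logb 2 (logb 2 n) + 6) := by
  have hn_pos : (0 : ℝ) < n := by exact_mod_cast (by lia : 0 < n)
  have hcard : (#{S : Finset (Fin n) | #S < ⌈logb 2 n⌉₊ + 2} : ℝ) ≤
      (Real.exp 1 * n / (⌈logb 2 n⌉₊ + 1 : ℕ)) ^ (⌈logb 2 n⌉₊ + 1) := by
    simpa [Nat.lt_succ_iff] using
      card_finset_card_le_le (α := Fin n) (Nat.succ_pos ⌈logb 2 (n : ℝ)⌉₊) (by simp; lia)
  have hLk : logb 2 n ≤ (⌈logb 2 n⌉₊ + 1 : ℕ) := by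
    push_cast
    linarith [Nat.le_ceil (logb 2 (n : ℝ))]
  have hkL : (⌈logb 2 n⌉₊ + 1 : ℕ) ≤ logb 2 n + 2 := by
    push_cast
    linarith [Nat.ceil_lt_add_one (a := logb 2 (n : ℝ)) (by linarith)]
  push_cast
  gcongr
  calc (n : ℝ) * #{S : Finset (Fin n) | #S < ⌈logb 2 n⌉₊ + 2}
      ≤ n * (n : ℝ) ^ (logb 2 n - logb 2 (logb 2 n) + 5) := by
        gcongr
        exact hcard.trans (exp_one_mul_div_pow_le hL hLk hkL)
    _ = (n : ℝ) ^ (logb 2 n - logb 2 (logb 2 n) + 6) := by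
        rw [mul_comm, ← Real.rpow_add_one hn_pos.ne']
        ring_nf

theorem whp_derivativeSum_le :
    WithHighProbability fun n f => (∃ y, f y = false) ∧ ∀ X : Finset (Fin n → Bool),
      (derivativeSum f X : ℝ≥0∞) ≤
        ENNReal.ofReal (2 ^ n * (n : ℝ) ^ (logb 2 n - logb 2 (logb 2 n) + 6)) := by
  refine whp_monochromaticDimLT.mono ?_
  filter_upwards [eventually_ceil_logb_add_two_le, tendsto_logb_natCast.eventually_ge_atTop 4]
    with n hm hL f hf
  refine ⟨hf.exists_apply_eq hm false, fun X => ?_⟩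
  refine (ENat.toENNReal_mono (derivativeSum_le hf hm X)).trans ?_
  rw [ENat.toENNReal_coe, ← ENNReal.ofReal_natCast]
  exact ENNReal.ofReal_le_ofReal (two_pow_mul_card_le hL hm)

theorem whp_hazardFreeSize_le :
    WithHighProbability fun n f => (hazardFreeSize f : ℝ≥0∞) ≤
      ENNReal.ofReal (2 ^ n * (n : ℝ) ^ (logb 2 n - logb 2 (logb 2 n) + 6)) :=
  whp_derivativeSum_le.mono <| .of_forall fun _ f hf =>
    (ENat.toENNReal_mono (hazardFreeSize_le_derivativeSum (covers_univ f) hf.1)).trans (hf.2 _)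

end UpperBound

section Rates

theorem tendsto_logb_logb_natCast :
    Tendsto (fun n : ℕ => logb 2 (logb 2 n)) atTop atTop :=
  (Real.tendsto_logb_atTop one_lt_two).comp tendsto_logb_natCast

theorem logb_logb_natCast_div_nonneg (n : ℕ) :
    0 ≤ logb 2 (logb 2 n) / (2 * logb 2 n) := by
  rcases lt_or_ge n 2 with hn | hn
  · interval_cases n <;> simp
  · have hL : 1 ≤ logb 2 n := by
      rw [Real.le_logb_iff_rpow_le one_lt_two (by positivity), Real.rpow_one]
      exact_mod_cast hn
    have := Real.logb_nonneg one_lt_two hL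
    positivity

theorem tendsto_logb_logb_natCast_div :
    Tendsto (fun n : ℕ => logb 2 (logb 2 n) / (2 * logb 2 n)) atTop (𝓝 0) := by
  have h := (Real.isLittleO_pow_logb_id_atTop (b := 2) (n := 1)).tendsto_div_nhds_zero.comp
    tendsto_logb_natCast |>.div_const 2
  simpa [Function.comp_def, div_div, mul_comm] using h

theorem natCast_rpow_le_rpow_one_sub {n : ℕ} (hl : 12 ≤ logb 2 (logb 2 n)) :
    (n : ℝ) ^ (logb 2 n - logb 2 (logb 2 n) + 6) ≤
      (n : ℝ) ^ ((1 - logb 2 (logb 2 n) / (2 * logb 2 n)) * logb 2 n) := by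
  have hL : logb 2 n ≠ 0 := fun h => by norm_num [h] at hl
  have hn : n ≠ 0 := fun h => hL (by simp [h])
  refine Real.rpow_le_rpow_of_exponent_le (by exact_mod_cast Nat.one_le_iff_ne_zero.2 hn) ?_
  field_simp
  linarith

theorem natCast_rpow_eq_div {n : ℕ} (hn : 0 < n) (hL : 1 < logb 2 n) :
    (n : ℝ) ^ (logb 2 n - logb 2 (logb 2 n) + 6) =
      (n : ℝ) ^ logb 2 n / logb 2 n ^ ((1 - 6 / logb 2 (logb 2 n)) * logb 2 n) := by
  have hl : 0 < logb 2 (logb 2 n) := Real.logb_pos one_lt_two hL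
  rw [logb_natCast_rpow_mul hn (one_pos.trans hL), ← Real.rpow_sub (by exact_mod_cast hn)]
  field_simp
  ring_nf

theorem whp_hazardFreeSize_le_rpow_one_sub :
    WithHighProbability fun n f => (hazardFreeSize f : ℝ≥0∞) ≤ ENNReal.ofReal
      (2 ^ n * (n : ℝ) ^ ((1 - logb 2 (logb 2 n) / (2 * logb 2 n)) * logb 2 n)) := by
  refine whp_hazardFreeSize_le.mono ?_
  filter_upwards [tendsto_logb_logb_natCast.eventually_ge_atTop 12] with n hl f hf
  refine hf.trans (ENNReal.ofReal_le_ofReal ?_)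
  gcongr ?_ * ?_
  exact natCast_rpow_le_rpow_one_sub hl

theorem whp_hazardFreeSize_le_rpow_div :
    WithHighProbability fun n f => (hazardFreeSize f : ℝ≥0∞) ≤ ENNReal.ofReal
      (2 ^ n * ((n : ℝ) ^ logb 2 n / logb 2 n ^ ((1 - 6 / logb 2 (logb 2 n)) * logb 2 n))) := by
  refine whp_hazardFreeSize_le.mono ?_
  filter_upwards [eventually_gt_atTop 0, tendsto_logb_natCast.eventually_gt_atTop 1]
    with n hn hL f hf
  rwa [← natCast_rpow_eq_div hn hL]

/-- The rate `((log n)² + 6 log n) / n` at which the exponent of the typical hazard-free formula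
size, divided by `n`, approaches `1`. -/
noncomputable def exponentRate (n : ℕ) : ℝ := (logb 2 n ^ 2 + 6 * logb 2 n) / n

theorem tendsto_exponentRate : Tendsto exponentRate atTop (𝓝 0) := by
  have h := (tendsto_logb_natCast_pow_div 2).add ((tendsto_logb_natCast_pow_div 1).const_mul 6)
  rw [mul_zero, add_zero] at h
  refine h.congr fun n => ?_
  rw [exponentRate, pow_one, add_div, mul_div_assoc]

theorem two_pow_mul_rpow_le {n : ℕ} (hn : 0 < n) (hL : 1 ≤ logb 2 n) :
    2 ^ n * (n : ℝ) ^ (logb 2 n - logb 2 (logb 2 n) + 6) ≤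
      2 ^ ((1 + exponentRate n) * n) := by
  have hl : 0 ≤ logb 2 (logb 2 n) := Real.logb_nonneg one_lt_two hL
  have hn' : (n : ℝ) ≠ 0 := by exact_mod_cast hn.ne'
  rw [natCast_rpow_eq_two_rpow hn, ← Real.rpow_natCast 2 n, ← Real.rpow_add two_pos, add_mul,
    one_mul, exponentRate, div_mul_cancel₀ _ hn']
  gcongr
  · exact one_le_two
  · nlinarith

theorem two_rpow_le_two_pow_div {n : ℕ} (hn : 0 < n) (hL : 1 ≤ logb 2 n) :
    2 ^ ((1 - exponentRate n) * n) ≤ (1 - 1 / 2) * 2 ^ n / logb 2 n := by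
  have hn' : (n : ℝ) ≠ 0 := by exact_mod_cast hn.ne'
  have hexp : (1 - exponentRate n) * n = n - (logb 2 n ^ 2 + 6 * logb 2 n) := by
    rw [sub_mul, one_mul, exponentRate, div_mul_cancel₀ _ hn']
  rw [le_div_iff₀ (one_pos.trans_le hL), hexp]
  calc (2 : ℝ) ^ (n - (logb 2 n ^ 2 + 6 * logb 2 n)) * logb 2 n
      ≤ 2 ^ (n - 1 - logb 2 n) * 2 ^ logb 2 n := by
        rw [two_rpow_logb_natCast hn]
        exact mul_le_mul (Real.rpow_le_rpow_of_exponent_le one_le_two (by nlinarith))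
          (logb_natCast_le n) (by linarith) (by positivity)
    _ = (1 - 1 / 2) * 2 ^ n := by
        rw [← Real.rpow_add two_pos, sub_add_cancel, Real.rpow_sub_one two_ne_zero,
          Real.rpow_natCast]
        ring

theorem whp_two_rpow_le_hazardFreeSize :
    WithHighProbability fun n f =>
      ENNReal.ofReal (2 ^ ((1 - exponentRate n) * n)) ≤ (hazardFreeSize f : ℝ≥0∞) := by
  refine (whp_le_hazardFreeSize one_half_pos).mono ?_
  filter_upwards [eventually_gt_atTop 0, tendsto_logb_natCast.eventually_ge_atTop 1]
    with n hn hL f hf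
  exact (ENNReal.ofReal_le_ofReal (two_rpow_le_two_pow_div hn hL)).trans hf

theorem whp_hazardFreeSize_le_two_rpow :
    WithHighProbability fun n f =>
      (hazardFreeSize f : ℝ≥0∞) ≤ ENNReal.ofReal (2 ^ ((1 + exponentRate n) * n)) := by
  refine whp_hazardFreeSize_le.mono ?_
  filter_upwards [eventually_gt_atTop 0, tendsto_logb_natCast.eventually_ge_atTop 1]
    with n hn hL f hf
  exact hf.trans (ENNReal.ofReal_le_ofReal (two_pow_mul_rpow_le hn hL))

theorem rpow_le_of_two_rpow_bounds {s t : ℝ≥0∞} {d a : ℝ} (ha : 0 ≤ a) (hd : 2 * d ≤ 1)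
    (ht : t ≤ ENNReal.ofReal (2 ^ ((1 + d) * a))) (hs : ENNReal.ofReal (2 ^ ((1 - d) * a)) ≤ s) :
    t ^ (1 - 2 * d) ≤ s := by
  calc t ^ (1 - 2 * d) ≤ ENNReal.ofReal (2 ^ ((1 + d) * a)) ^ (1 - 2 * d) :=
        ENNReal.rpow_le_rpow ht (by linarith)
    _ = ENNReal.ofReal (2 ^ ((1 + d) * a * (1 - 2 * d))) := by
        rw [ENNReal.ofReal_rpow_of_pos (by positivity), ← Real.rpow_mul two_pos.le]
    _ ≤ ENNReal.ofReal (2 ^ ((1 - d) * a)) :=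
        ENNReal.ofReal_le_ofReal (Real.rpow_le_rpow_of_exponent_le one_le_two
          (by nlinarith [mul_nonneg ha (sq_nonneg d)]))
    _ ≤ s := hs

theorem whp_derivativeSum_rpow_le_hazardFreeSize :
    WithHighProbability fun n f => ∀ X : Finset (Fin n → Bool),
      (derivativeSum f X : ℝ≥0∞) ^ (1 - 2 * exponentRate n) ≤ (hazardFreeSize f : ℝ≥0∞) ∧
        (Covers f X → hazardFreeSize f ≤ derivativeSum f X) := by
  refine (whp_two_rpow_le_hazardFreeSize.and whp_derivativeSum_le).mono ?_
  filter_upwards [eventually_gt_atTop 0, tendsto_logb_natCast.eventually_ge_atTop 1,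
    tendsto_exponentRate.eventually_le_const one_half_pos] with n hn hL hd f ⟨hlower, hf, hupper⟩ X
  have hsum := (hupper X).trans (ENNReal.ofReal_le_ofReal (two_pow_mul_rpow_le hn hL))
  exact ⟨rpow_le_of_two_rpow_bounds n.cast_nonneg (by linarith) hsum hlower,
    fun hX => hazardFreeSize_le_derivativeSum hX hf⟩

end Rates

end HazardFree

open HazardFree in
theorem theorem1p15_general :
    (∀ ε : ℝ, 0 < ε →
      WithHighProbability fun n f =>
        ENNReal.ofReal ((1 - ε) * 2 ^ n / Real.logb 2 n) ≤ (hazardFreeSize f : ℝ≥0∞)) ∧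
    (∃ δ : ℕ → ℝ, (∀ n, 0 ≤ δ n) ∧ Tendsto δ atTop (𝓝 0) ∧
      WithHighProbability fun n f =>
        (hazardFreeSize f : ℝ≥0∞)
          ≤ ENNReal.ofReal (2 ^ n * (n : ℝ) ^ ((1 - δ n) * Real.logb 2 n))) ∧
    (∃ δ : ℕ → ℝ, Tendsto δ atTop (𝓝 0) ∧
      WithHighProbability fun n f =>
        (hazardFreeSize f : ℝ≥0∞)
          ≤ ENNReal.ofReal (2 ^ n * ((n : ℝ) ^ Real.logb 2 n /
              Real.logb 2 n ^ ((1 - δ n) * Real.logb 2 n)))) ∧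
    (∃ δ : ℕ → ℝ, Tendsto δ atTop (𝓝 0) ∧
      WithHighProbability fun n f =>
        ENNReal.ofReal ((2 : ℝ) ^ ((1 - δ n) * n)) ≤ (hazardFreeSize f : ℝ≥0∞) ∧
        (hazardFreeSize f : ℝ≥0∞) ≤ ENNReal.ofReal ((2 : ℝ) ^ ((1 + δ n) * n))) ∧
    (∃ δ : ℕ → ℝ, Tendsto δ atTop (𝓝 0) ∧
      WithHighProbability fun n f => ∀ X : Finset (Fin n → Bool),
        (derivativeSum f X : ℝ≥0∞) ^ (1 - δ n) ≤ (hazardFreeSize f : ℝ≥0∞) ∧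
        (Covers f X → hazardFreeSize f ≤ derivativeSum f X)) :=
  ⟨fun _ hε => whp_le_hazardFreeSize hε,
    ⟨_, logb_logb_natCast_div_nonneg, tendsto_logb_logb_natCast_div,
      whp_hazardFreeSize_le_rpow_one_sub⟩,
    ⟨_, tendsto_logb_logb_natCast.const_div_atTop 6, whp_hazardFreeSize_le_rpow_div⟩,
    ⟨_, tendsto_exponentRate,
      whp_two_rpow_le_hazardFreeSize.and whp_hazardFreeSize_le_two_rpow⟩,
    ⟨_, by simpa using tendsto_exponentRate.const_mul 2,
      whp_derivativeSum_rpow_le_hazardFreeSize⟩⟩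

theorem theorem1p15 :
    -- lower bound: (1 - o(1)) * 2^n / log n
    (∀ ε : ℝ, 0 < ε →
      HazardFree.WithHighProbability fun n f =>
        ENNReal.ofReal ((1 - ε) * 2 ^ n / Real.logb 2 n)
          ≤ (HazardFree.hazardFreeSize f : ℝ≥0∞)) ∧
    -- upper bound: 2^n * n^((1 - o(1)) * log n)
    (∃ δ : ℕ → ℝ, (∀ n, 0 ≤ δ n) ∧ Tendsto δ atTop (𝓝 0) ∧
      HazardFree.WithHighProbability fun n f =>
        (HazardFree.hazardFreeSize f : ℝ≥0∞)
          ≤ ENNReal.ofReal (2 ^ n * (n : ℝ) ^ ((1 - δ n) * Real.logb 2 n))) ∧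
    -- sharper upper bound: 2^n * n^(log n) / (log n)^((1 - o(1)) * log n)
    (∃ δ : ℕ → ℝ, Tendsto δ atTop (𝓝 0) ∧
      HazardFree.WithHighProbability fun n f =>
        (HazardFree.hazardFreeSize f : ℝ≥0∞)
          ≤ ENNReal.ofReal (2 ^ n * ((n : ℝ) ^ Real.logb 2 n /
              Real.logb 2 n ^ ((1 - δ n) * Real.logb 2 n)))) ∧
    -- the size is 2^((1 + o(1)) * n)
    (∃ δ : ℕ → ℝ, Tendsto δ atTop (𝓝 0) ∧
      HazardFree.WithHighProbability fun n f =>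
        ENNReal.ofReal ((2 : ℝ) ^ ((1 - δ n) * n)) ≤ (HazardFree.hazardFreeSize f : ℝ≥0∞) ∧
        (HazardFree.hazardFreeSize f : ℝ≥0∞) ≤ ENNReal.ofReal ((2 : ℝ) ^ ((1 + δ n) * n))) ∧
    -- the sum over a minimum covering set is tight up to the exponent 1 - o(1)
    (∃ δ : ℕ → ℝ, Tendsto δ atTop (𝓝 0) ∧
      HazardFree.WithHighProbability fun n f =>
        ∀ X : Finset (Fin n → Bool), HazardFree.IsMinimumCover f X →
          (HazardFree.derivativeSum f X : ℝ≥0∞) ^ (1 - δ n)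
            ≤ (HazardFree.hazardFreeSize f : ℝ≥0∞) ∧
          HazardFree.hazardFreeSize f ≤ HazardFree.derivativeSum f X) := by
  refine theorem1p15_general.imp_right <| .imp_right <| .imp_right <| .imp_right ?_
  exact fun ⟨δ, hδ, h⟩ => ⟨δ, hδ, h.mono <| .of_forall fun _ _ hf X hX => (hf X).imp_right (· hX.1)⟩
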